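/- A partition is a list $\pi=(1^{f_1},2^{f_2},3^{f_3},\dots)$ of frequencies $f_i\in\mathbb{Z}_{\ge 0}$, all but finitely many of which are zero. Write $|\pi|=\sum_{i\ge1} i f_i$ for its size and $\#(\pi)=\sum_{i\ge 1} f_i$ for its number of parts. Let $t(\pi)$ be the length of the initial frequency chain, i.e. the largest $t\ge 0$ such that $f_1,\dots,f_t$ are all non-zero. For $j\ge1$ let $p_j(\pi)$ be the largest index $i$ with $f_i\ge j$ (and $p_j(\pi)=0$ if there is no such $i$), and let $r_j(\pi)$ be the number of indices $i$ with $f_i\ge j$. Let $\mathcal{D}$ be the set of distinct partitions (all $f_i\le 1$), and let $\mathcal{A}$ be the set of partitions $\pi$ with $p_2(\pi)\le t(\pi)$. Then, for $i=1$ and $i=2$, as formal power series in $q$, $$\sum_{\pi\in\mathcal{D}} w_i(\pi)\,q^{|\pi|}=\sum_{\pi\in\mathcal{A}}\hat{w}_i(\pi)\,q^{|\pi|},$$ where $$w_i(\pi)=\left[1-f_1\left(\frac{1-(-1)^{t(\pi)}}{2}\right)\right](-1)^{i\,\#(\pi)},$$ $$\hat{w}_i(\pi)=2^{r_2(\pi)}\left(\frac{(-1)^{t(\pi)}+(-1)^{p_2(\pi)}}{2}\right)(-1)^{(i-1)(r_1(\pi)+t(\pi)+p_2(\pi))}.$$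 -/

import Mathlib

open scoped PowerSeries PowerSeries.WithPiTopology

/-- An integer partition of arbitrary size, as a pair `⟨n, π⟩` with `π` a partition of `n`. -/
abbrev IntPartition : Type := Σ n : ℕ, n.Partition

namespace IntPartition

/-- The size `|π| = ∑ i * f_i` of `π`, that is, the sum of its parts. -/
def size (π : IntPartition) : ℕ := π.2.parts.sum

/-- The frequency `f_i` of `i` in `π = (1^{f_1}, 2^{f_2}, …)`. -/
def freq (π : IntPartition) (i : ℕ) : ℕ := π.2.parts.count i

/-- The number `#(π)` of parts of `π`, counted with multiplicity. -/
def numParts (π : IntPartition) : ℕ := π.2.parts.card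

theorem exists_freq_succ_eq_zero (π : IntPartition) : ∃ m, π.freq (m + 1) = 0 := by
  refine ⟨π.1, Multiset.count_eq_zero.2 fun h => ?_⟩
  have := π.2.le_of_mem_parts h
  omega

/-- The length `t(π)` of the initial frequency chain: the number of consecutive nonzero
frequencies `f_1, f_2, …, f_t` at the beginning, i.e. the least `t` with `f_{t+1} = 0`. -/
def t (π : IntPartition) : ℕ := Nat.find π.exists_freq_succ_eq_zero

/-- The set of the different parts of `π` whose frequency is at least `j`. -/
def partsWithFreqGE (π : IntPartition) (j : ℕ) : Finset ℕ :=
  {i ∈ π.2.parts.toFinset | j ≤ π.freq i}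

/-- `p_j(π)`, for `j ≥ 1`: the largest `i` with `f_i ≥ j`, and `0` if there is none. -/
def p (j : ℕ) (π : IntPartition) : ℕ := (π.partsWithFreqGE j).sup id

/-- `r_j(π)`, for `j ≥ 1`: the number of different parts with frequency at least `j`. -/
def r (j : ℕ) (π : IntPartition) : ℕ := (π.partsWithFreqGE j).card

/-- The weight `w_i`. -/
def w (i : ℕ) (π : IntPartition) : ℚ :=
  (1 - (π.freq 1 : ℚ) * ((1 - (-1) ^ π.t) / 2)) * (-1) ^ (i * π.numParts)

/-- The weight `ŵ_i`, for `i ≥ 1`. -/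
def wHat (i : ℕ) (π : IntPartition) : ℚ :=
  2 ^ π.r 2 * (((-1) ^ π.t + (-1) ^ π.p 2) / 2) * (-1) ^ ((i - 1) * (π.r 1 + π.t + π.p 2))

/-- The set `𝒟` of distinct partitions: no frequency exceeds `1`. -/
def distinct : Set IntPartition := {π | ∀ i, π.freq i ≤ 1}

/-- The set `𝒜` of partitions with `p_2(π) ≤ t(π)`. -/
def chainBounded : Set IntPartition := {π | π.p 2 ≤ π.t}

end IntPartition

/-!
Put `ε = 1` for `i = 1` and `ε = -1` for `i = 2`. The parity factor `((-1) ^ t + (-1) ^ p) / 2` is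
the alternating sum `∑ (-1) ^ j` over `p ≤ j ≤ t`, and `1 - f 1 * (1 - (-1) ^ t) / 2` is the same
sum over `0 ≤ j ≤ t` when `f 1 ≤ 1`. With the index `j` fixed, what remains is a product over the
part sizes of a function of the frequency: the chain condition `j ≤ t` requires the parts
`1, …, j`, and `p 2 ≤ j` forbids repetitions beyond `j` (`IntPartition.sum_once_eq_w`,
`IntPartition.sum_atLeastOnce_eq_wHat`). Such weights have product generating functions
(`Nat.Partition.coeff_prod_factor`), so, with `T j = j (j + 1) / 2`, the two sides are

* `∑_j ε ^ j q ^ T j ∏_{i > j} (1 - ε q ^ i)`,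
* `∑_p (-ε) ^ p q ^ T p (-q; q)_p / (q; q)_p ∏_{i > p} (1 + ε q ^ i)`.

If `ε = 1`, the products combine with the `q`-factorials, and Euler's expansion evaluates both sides
to `∏_{i ≥ 1} (1 + q ^ i) (1 - q ^ i)`. If `ε = -1`, the sides are the values at `k = 0` of two
families of series, `chainSeries` and `repeatedSeries`, which both satisfy
`F k + (1 + q ^ (k + 1)) F (k + 1) = 2 ∏_{i ≥ 1} (1 + q ^ i)`. They have the same limit as
`k → ∞`, hence they are equal. For `chainSeries` the recurrence is a telescoping sum; for
`repeatedSeries` it comes down to an instance of the `q`-Gauss sum (`gaussSeries_eq_tail`).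

Only the coefficients up to some degree `N` matter at a time, so the `q`-series are handled in a
ring where `q ^ (N + 1) = 0`: there all sums and products are finite, shifting an infinite product
is an exact identity (`tail_eq_mul_tail_succ`), and a limit `k → ∞` is the value for `k > N`.
-/

/-! ### Truncated products and `q`-factorials -/

namespace TruncatedQSeries

variable {R : Type*} [CommRing R] {q : R} {N : ℕ}

/-- The product `∏_{i ≥ a} (1 + y q ^ i)`. It is cut off at `i = N`, which loses nothing when
`q ^ (N + 1) = 0`. -/
def tail (q : R) (N : ℕ) (y : R) (a : ℕ) : R := ∏ i ∈ Finset.Ico a (N + 1), (1 + y * q ^ i)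

/-- The `q`-shifted factorial `(-q ^ a; q)_n = ∏_{i < n} (1 + q ^ (a + i))`. -/
def rising (q : R) (a n : ℕ) : R := ∏ i ∈ Finset.range n, (1 + q ^ (a + i))

/-- The inverse `1 / (q; q)_n` of the `q`-factorial. -/
noncomputable def invFactorial (q : R) (n : ℕ) : R :=
  ∏ i ∈ Finset.range n, Ring.inverse (1 - q ^ (i + 1))

theorem pow_eq_zero_of_lt (hq : q ^ (N + 1) = 0) {n : ℕ} (hn : N < n) : q ^ n = 0 :=
  pow_eq_zero_of_le hn hq

theorem one_sub_pow_mul_inverse (hq : q ^ (N + 1) = 0) {i : ℕ} (hi : i ≠ 0) :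
    (1 - q ^ i) * Ring.inverse (1 - q ^ i) = 1 := by
  have h : IsNilpotent (q ^ i) := IsNilpotent.pow_of_pos ⟨N + 1, hq⟩ hi
  exact Ring.mul_inverse_cancel _ h.isUnit_one_sub

theorem one_sub_mul_invFactorial_succ (hq : q ^ (N + 1) = 0) (n : ℕ) :
    (1 - q ^ (n + 1)) * invFactorial q (n + 1) = invFactorial q n := by
  rw [invFactorial, Finset.prod_range_succ, ← invFactorial]
  linear_combination invFactorial q n * one_sub_pow_mul_inverse hq n.add_one_ne_zero

theorem tail_eq_mul_tail_succ (hq : q ^ (N + 1) = 0) (y : R) (a : ℕ) :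
    tail q N y a = (1 + y * q ^ a) * tail q N y (a + 1) := by
  unfold tail
  rcases Nat.lt_or_ge a (N + 1) with h | h
  · exact Finset.prod_eq_prod_Ico_succ_bot h _
  · simp [Finset.Ico_eq_empty_of_le h, Finset.Ico_eq_empty_of_le (h.trans a.le_succ),
      pow_eq_zero_of_lt hq h]

theorem tail_of_lt {a : ℕ} (h : N < a) (y : R) : tail q N y a = 1 := by
  simp [tail, Finset.Ico_eq_empty_of_le (Nat.succ_le_of_lt h)]

theorem pow_choose_succ (q : R) (n : ℕ) :
    q ^ (n + 2).choose 2 = q ^ (n + 1).choose 2 * q ^ (n + 1) := by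
  rw [Nat.choose_succ_succ' (n + 1) 1, Nat.choose_one_right, add_comm, pow_add]

theorem pow_choose_eq_zero (hq : q ^ (N + 1) = 0) : q ^ (N + 2).choose 2 = 0 := by
  rw [pow_choose_succ, hq, mul_zero]

theorem rising_succ (q : R) (a n : ℕ) :
    rising q a (n + 1) = rising q a n * (1 + q ^ (a + n)) :=
  Finset.prod_range_succ _ _

theorem rising_succ' (q : R) (a n : ℕ) :
    rising q a (n + 1) = (1 + q ^ a) * rising q (a + 1) n := by
  rw [rising, Finset.prod_range_succ', mul_comm, rising]
  simp only [add_zero]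
  congr 1
  exact Finset.prod_congr rfl fun i _ => by rw [add_assoc, add_comm 1 i]

theorem rising_mul_tail (hq : q ^ (N + 1) = 0) (n : ℕ) :
    rising q 1 n * tail q N 1 (n + 1) = tail q N 1 1 := by
  induction n with
  | zero => simp [rising]
  | succ n ih =>
    rw [← ih, rising_succ, tail_eq_mul_tail_succ hq 1 (n + 1), add_comm 1 n]
    ring

theorem invFactorial_mul_tail (hq : q ^ (N + 1) = 0) (n : ℕ) :
    invFactorial q n * tail q N (-1) 1 = tail q N (-1) (n + 1) := by
  induction n with
  | zero => simp [invFactorial]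
  | succ n ih =>
    rw [invFactorial, Finset.prod_range_succ, ← invFactorial, mul_right_comm, ih,
      tail_eq_mul_tail_succ hq (-1) (n + 1)]
    linear_combination
      tail q N (-1) (n + 2) * one_sub_pow_mul_inverse hq n.add_one_ne_zero

/-- If the difference of two sequences satisfies a homogeneous first-order recurrence, they agree as
soon as they agree far out. -/
theorem eq_of_recurrence {F G a : ℕ → R} (hrec : ∀ k, F k - G k = a k * (F (k + 1) - G (k + 1)))
    (hlarge : ∀ k, N < k → F k = G k) (k : ℕ) : F k = G k := by
  have key : ∀ d k, N < k + d → F k = G k := by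
    intro d
    induction d with
    | zero => exact hlarge
    | succ d ih =>
      intro k hk
      have := ih (k + 1) (by omega)
      rw [← sub_eq_zero, hrec, this, sub_self, mul_zero]
  exact key (N + 1) k (by omega)

/-! ### Euler's expansion -/

/-- Euler's series `∑_n y ^ n q ^ (n (n + 1) / 2 + k n) / (q; q)_n`. -/
noncomputable def eulerSeries (q : R) (N : ℕ) (y : R) (k : ℕ) : R :=
  ∑ n ∈ Finset.range (N + 1), invFactorial q n * y ^ n * q ^ (n + 1).choose 2 * (q ^ k) ^ n

theorem eulerSeries_eq_mul (hq : q ^ (N + 1) = 0) (y : R) (k : ℕ) :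
    eulerSeries q N y k = (1 + y * q ^ (k + 1)) * eulerSeries q N y (k + 1) := by
  let v : ℕ → R := fun n =>
    (1 - q ^ n) * invFactorial q n * y ^ n * q ^ (n + 1).choose 2 * (q ^ k) ^ n
  have hv0 : v 0 = 0 := by simp [v]
  have hvN : v (N + 1) = 0 := by simp [v, pow_choose_eq_zero hq]
  rw [← sub_eq_zero, eulerSeries, eulerSeries, Finset.mul_sum, ← Finset.sum_sub_distrib,
    ← sub_eq_zero.2 (hv0.trans hvN.symm), ← Finset.sum_range_sub' v]
  refine Finset.sum_congr rfl fun n _ => ?_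
  simp only [v, one_sub_mul_invFactorial_succ hq, pow_choose_succ]
  ring

/-- Sums over `n` of multiples of `x ^ n` reduce to the term `n = 0` when `x = 0`. -/
theorem sum_range_mul_zero_pow (c : ℕ → R) :
    ∑ n ∈ Finset.range (N + 1), c n * 0 ^ n = c 0 := by
  rw [Finset.sum_range_succ', Finset.sum_eq_zero fun n _ => by simp]
  simp

/-- Euler: `∑_n y ^ n q ^ (n (n + 1) / 2) / (q; q)_n = ∏_{i ≥ 1} (1 + y q ^ i)`. -/
theorem eulerSeries_eq_tail (hq : q ^ (N + 1) = 0) (y : R) (k : ℕ) :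
    eulerSeries q N y k = tail q N y (k + 1) := by
  refine eq_of_recurrence (N := N) (G := fun k => tail q N y (k + 1))
    (a := fun k => 1 + y * q ^ (k + 1)) (fun k => ?_) (fun k hk => ?_) k
  · rw [eulerSeries_eq_mul hq, tail_eq_mul_tail_succ hq]
    ring
  · rw [tail_of_lt (hk.trans k.lt_succ_self), eulerSeries, pow_eq_zero_of_lt hq hk,
      sum_range_mul_zero_pow]
    simp [invFactorial]

/-! ### The two sides as solutions of one recurrence -/

/-- The series `∑_n (-1) ^ n q ^ (n (n + 1) / 2 + k n) ∏_{i > n} (1 + q ^ i)`. For `k = 0` it counts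
the distinct partitions with an initial chain of even length. -/
def chainSeries (q : R) (N k : ℕ) : R :=
  ∑ n ∈ Finset.range (N + 1),
    (-1) ^ n * q ^ (n + 1).choose 2 * tail q N 1 (n + 1) * (q ^ k) ^ n

/-- The series `∑_n (-q ^ (k + 1); q)_n / (q; q)_n q ^ (n (n + 1) / 2) ∏_{i > n + k} (1 - q ^ i)`.
For `k = 0` it is the generating function of the weights `wHat 2`. -/
noncomputable def repeatedSeries (q : R) (N k : ℕ) : R :=
  ∑ n ∈ Finset.range (N + 1),
    rising q (k + 1) n * invFactorial q n * q ^ (n + 1).choose 2 * tail q N (-1) (n + k + 1)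

theorem chainSeries_add (hq : q ^ (N + 1) = 0) (k : ℕ) :
    chainSeries q N k + (1 + q ^ (k + 1)) * chainSeries q N (k + 1) = 2 * tail q N 1 1 := by
  let v : ℕ → R := fun n => (-1) ^ n * q ^ (n + 1).choose 2 * tail q N 1 n * (q ^ k) ^ n
  have hv0 : v 0 = 2 * tail q N 1 1 := by
    simp [v, tail_eq_mul_tail_succ hq 1 0, one_add_one_eq_two]
  have hvN : v (N + 1) = 0 := by simp [v, pow_choose_eq_zero hq]
  rw [← hv0, ← sub_zero (v 0), ← hvN, ← Finset.sum_range_sub' v, chainSeries, chainSeries,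
    Finset.mul_sum, ← Finset.sum_add_distrib]
  refine Finset.sum_congr rfl fun n _ => ?_
  simp only [v, pow_choose_succ, tail_eq_mul_tail_succ hq 1 n]
  ring

/-- A limiting case of the `q`-Gauss series,
`∑_n (-q ^ (k + 1); q)_n / (q; q)_n q ^ (n (n + 1) / 2) ∏_{i > n + k + 1} (1 - q ^ i)`.
Its value does not depend on `k`. -/
noncomputable def gaussSeries (q : R) (N k : ℕ) : R :=
  ∑ n ∈ Finset.range (N + 1),
    rising q (k + 1) n * invFactorial q n * q ^ (n + 1).choose 2 * tail q N (-1) (n + k + 2)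

/-- The differences of the terms of `gaussSeries` for `k` and for `k + 1` telescope. -/
theorem sum_gaussSeries_terms_sub (hq : q ^ (N + 1) = 0) (k M : ℕ) :
    ∑ n ∈ Finset.range (M + 1),
      (rising q (k + 1) n * invFactorial q n * q ^ (n + 1).choose 2 * tail q N (-1) (n + k + 2) -
        rising q (k + 2) n * invFactorial q n * q ^ (n + 1).choose 2 *
          tail q N (-1) (n + k + 3)) =
      -(q ^ (k + 1) * rising q (k + 2) M * invFactorial q M * q ^ (M + 2).choose 2 *
        tail q N (-1) (M + k + 3)) := by
  induction M with
  | zero =>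
    rw [Finset.sum_range_one, tail_eq_mul_tail_succ hq (-1) (0 + k + 2)]
    simp [rising, invFactorial]
    ring
  | succ M ih =>
    rw [Finset.sum_range_succ, ih, ← one_sub_mul_invFactorial_succ hq M, rising_succ' q (k + 1) M,
      rising_succ q (k + 2) M, pow_choose_succ q (M + 1),
      show M + 1 + k + 2 = M + k + 3 by ring, show M + 1 + k + 3 = M + k + 3 + 1 by ring,
      tail_eq_mul_tail_succ hq (-1) (M + k + 3)]
    ring

theorem gaussSeries_eq_tail (hq : q ^ (N + 1) = 0) (k : ℕ) :
    gaussSeries q N k = tail q N 1 1 := by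
  refine eq_of_recurrence (N := N) (G := fun _ => tail q N 1 1) (a := fun _ => 1)
    (fun k => ?_) (fun k hk => ?_) k
  · have h := sum_gaussSeries_terms_sub hq k N
    rw [pow_choose_eq_zero hq, Finset.sum_sub_distrib] at h
    simp only [gaussSeries]
    linear_combination h
  · rw [← eulerSeries_eq_tail hq 1 0, gaussSeries, eulerSeries]
    refine Finset.sum_congr rfl fun n _ => ?_
    rw [tail_of_lt (by omega), rising, Finset.prod_eq_one fun i _ => by
      rw [pow_eq_zero_of_lt hq (by omega), add_zero]]
    simp

theorem repeatedSeries_add (hq : q ^ (N + 1) = 0) (k : ℕ) :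
    repeatedSeries q N k + (1 + q ^ (k + 1)) * repeatedSeries q N (k + 1) =
      2 * tail q N 1 1 := by
  rw [← gaussSeries_eq_tail hq k, repeatedSeries, repeatedSeries, gaussSeries,
    Finset.mul_sum, ← Finset.sum_add_distrib, Finset.mul_sum]
  refine Finset.sum_congr rfl fun n _ => ?_
  have h := (rising_succ' q (k + 1) n).symm.trans (rising_succ q (k + 1) n)
  rw [tail_eq_mul_tail_succ hq (-1) (n + k + 1), show n + (k + 1) + 1 = n + k + 2 by ring]
  linear_combination invFactorial q n * q ^ (n + 1).choose 2 * tail q N (-1) (n + k + 2) * h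

theorem chainSeries_eq_repeatedSeries (hq : q ^ (N + 1) = 0) (k : ℕ) :
    chainSeries q N k = repeatedSeries q N k := by
  refine eq_of_recurrence (N := N) (a := fun k => -(1 + q ^ (k + 1)))
    (fun k => ?_) (fun k hk => ?_) k
  · linear_combination chainSeries_add hq k - repeatedSeries_add hq k
  · have h : repeatedSeries q N k = tail q N 1 1 := by
      rw [← eulerSeries_eq_tail hq 1 0, repeatedSeries, eulerSeries]
      refine Finset.sum_congr rfl fun n _ => ?_
      rw [tail_of_lt (by omega), rising, Finset.prod_eq_one fun i _ => by
        rw [pow_eq_zero_of_lt hq (by omega), add_zero]]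
      simp
    rw [h, chainSeries, pow_eq_zero_of_lt hq hk, sum_range_mul_zero_pow]
    simp

/-- The `q`-series form of the theorem, for both signs `ε`. -/
theorem sum_tail_eq_sum_rising_tail (hq : q ^ (N + 1) = 0) {ε : R} (hε : ε = 1 ∨ ε = -1) :
    ∑ j ∈ Finset.range (N + 1), ε ^ j * (q ^ (j + 1).choose 2 * tail q N (-ε) (j + 1)) =
      ∑ p ∈ Finset.range (N + 1), (-ε) ^ p * (q ^ (p + 1).choose 2 *
        (rising q 1 p * invFactorial q p) * tail q N ε (p + 1)) := by
  rcases hε with rfl | rfl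
  · trans tail q N 1 1 * tail q N (-1) 1
    · rw [← eulerSeries_eq_tail hq 1 0, eulerSeries, Finset.sum_mul]
      refine Finset.sum_congr rfl fun n _ => ?_
      rw [← invFactorial_mul_tail hq n]
      ring
    · rw [← eulerSeries_eq_tail hq (-1) 0, eulerSeries, Finset.mul_sum]
      refine Finset.sum_congr rfl fun n _ => ?_
      rw [← rising_mul_tail hq n]
      ring
  · rw [neg_neg]
    convert chainSeries_eq_repeatedSeries hq 0 using 1
    · exact Finset.sum_congr rfl fun n _ => by ring
    · exact Finset.sum_congr rfl fun n _ => by ring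

end TruncatedQSeries

open TruncatedQSeries

/-! ### Multiplicative weights of partitions -/

namespace Nat.Partition

variable {R : Type*} [CommSemiring R]

/-- The factor `∑_m f m * X ^ (i * m)` that the part size `i` contributes to a generating function
of partitions, if a frequency `m` of `i` has weight `f m`. -/
noncomputable def factor (i : ℕ) (f : ℕ → R) : R⟦X⟧ :=
  PowerSeries.mk fun m => if i ∣ m then f (m / i) else 0

/-- Generating function of a multiplicative weight on partitions. Unlike `Nat.Partition.genFun`,
this allows weights for which the absence of a part has a weight other than `1`. -/
theorem coeff_prod_factor (c : ℕ → ℕ → R) (n : ℕ) :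
    PowerSeries.coeff n (∏ i ∈ Finset.Icc 1 n, factor i (c i)) =
      ∑ π : n.Partition, ∏ i ∈ Finset.Icc 1 n, c i (π.parts.count i) := by
  rw [PowerSeries.coeff_prod]
  refine (Finset.sum_of_injOn toFinsuppAntidiag (toFinsuppAntidiag_injective n).injOn
    (fun π _ => π.toFinsuppAntidiag_mem_finsuppAntidiag) (fun g hg hg' => ?_)
    (fun π _ => Finset.prod_congr rfl fun i hi => ?_)).symm
  · obtain ⟨h1, h2⟩ := Finset.mem_finsuppAntidiag.1 hg
    suffices h : ∃ i ∈ Finset.Icc 1 n, ¬ i ∣ g i by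
      obtain ⟨i, hi, hd⟩ := h
      exact Finset.prod_eq_zero hi (by simp [factor, hd])
    -- If every `i` divides `g i`, then the `g i / i` are the frequencies of a partition of `n`.
    by_contra! hd
    have hd' : ∀ i, g i / i * i = g i := fun i => by
      by_cases hi : i ∈ Finset.Icc 1 n
      · exact Nat.div_mul_cancel (hd i hi)
      · have : g i = 0 := by
          by_contra h
          exact hi (h2 (Finsupp.mem_support_iff.2 h))
        simp [this]
    have hsupp : ∀ i, g i / i ≠ 0 ↔ i ∈ g.support := fun i => by
      rw [Finsupp.mem_support_iff, not_iff_not]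
      constructor
      · intro h
        rw [← hd' i, h, zero_mul]
      · intro h
        rw [h, Nat.zero_div]
    refine hg' ⟨⟨(Finsupp.mk g.support (fun i => g i / i) fun i => (hsupp i).symm).toMultiset,
      fun {i} hi => ?_, ?_⟩, by simp, ?_⟩
    · have hi' : i ∈ g.support := by simpa using hi
      exact (Finset.mem_Icc.1 (h2 hi')).1
    · have h : ∑ i ∈ g.support, g i / i * i = n := by
        simp only [hd']
        exact (Finset.sum_subset h2 fun i _ hi => by simpa using hi).trans h1
      simpa [Finsupp.sum] using h
    · ext i
      simpa [toFinsuppAntidiag] using hd' i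
  · have hi0 : 0 < i := (Finset.mem_Icc.1 hi).1
    simp [factor, toFinsuppAntidiag, hi0]

end Nat.Partition

/-! ### Generating functions of the weights that occur -/

namespace FreqWeight

variable {R : Type*} [CommRing R]

/-- The weight of a frequency that selects the value `1`. -/
def once (m : ℕ) : R := if m = 1 then 1 else 0

/-- The weight of a frequency that allows the values `0` and `1`, with weight `y` for `1`. -/
def atMostOnce (y : R) (m : ℕ) : R := if m = 0 then 1 else if m = 1 then y else 0

/-- The weight of a frequency that requires it to be positive, and counts repeated parts twice. -/
def atLeastOnce (m : ℕ) : R := if m = 0 then 0 else if m = 1 then 1 else 2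

end FreqWeight

namespace Nat.Partition

open PowerSeries FreqWeight

variable {R : Type*} [CommRing R]

theorem factor_eq_expand {i : ℕ} (hi : i ≠ 0) (f : ℕ → R) :
    factor i f = PowerSeries.expand i hi (PowerSeries.mk f) := by
  ext m
  simp [factor, coeff_expand]

theorem factor_once {i : ℕ} (hi : i ≠ 0) : factor i (once : ℕ → R) = X ^ i := by
  rw [factor_eq_expand hi, ← expand_X i hi]
  congr 1
  ext m
  simp [once, coeff_X]

theorem factor_atMostOnce {i : ℕ} (hi : i ≠ 0) (y : R) :
    factor i (atMostOnce y) = 1 + C y * X ^ i := by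
  have h : PowerSeries.mk (atMostOnce y) = 1 + C y * X := by
    ext m
    rcases m with _ | _ | m <;> simp [atMostOnce, coeff_one]
  rw [factor_eq_expand hi, h, map_add, map_mul, map_one, expand_X, expand_C]

theorem one_sub_mul_factor_atLeastOnce {i : ℕ} (hi : i ≠ 0) :
    (1 - X ^ i) * factor i (atLeastOnce : ℕ → R) = X ^ i * (1 + X ^ i) := by
  have h : (1 - X) * PowerSeries.mk (atLeastOnce : ℕ → R) = X * (1 + X) := by
    ext m
    rw [sub_mul, one_mul, map_sub]
    rcases m with _ | _ | _ | m
    · simp [atLeastOnce]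
    · simp [atLeastOnce, coeff_succ_X_mul]
    · simp only [coeff_succ_X_mul, coeff_mk, atLeastOnce, map_add, coeff_one, coeff_X]
      norm_num
    · simp [atLeastOnce, coeff_succ_X_mul, coeff_one, coeff_X]
  rw [factor_eq_expand hi, ← expand_X i hi, ← map_one (expand i hi), ← map_sub, ← map_mul, h,
    map_mul, map_add]

theorem prod_factor_ite (f g : ℕ → R) {j n : ℕ} (hj : j ≤ n) :
    ∏ i ∈ Finset.Icc 1 n, factor i (if i ≤ j then f else g) =
      (∏ i ∈ Finset.Icc 1 j, factor i f) * ∏ i ∈ Finset.Ico (j + 1) (n + 1), factor i g := by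
  have h1 : Finset.Icc 1 n = Finset.Ico 1 (n + 1) := by ext; simp
  have h2 : Finset.Icc 1 j = Finset.Ico 1 (j + 1) := by ext; simp
  rw [h1, h2, ← Finset.prod_Ico_consecutive _ (Nat.le_add_left 1 j) (by omega : j + 1 ≤ n + 1)]
  congr 1
  · exact Finset.prod_congr rfl fun i hi => by
      rw [if_pos (by have := Finset.mem_Ico.1 hi; omega)]
  · exact Finset.prod_congr rfl fun i hi => by
      rw [if_neg (by have := Finset.mem_Ico.1 hi; omega)]

section Quotient

variable {S : Type*} [CommRing S] (F : R⟦X⟧ →+* S) {n : ℕ}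

theorem map_prod_factor_once (j : ℕ) :
    F (∏ i ∈ Finset.Icc 1 j, factor i once) = F X ^ (j + 1).choose 2 := by
  induction j with
  | zero => simp
  | succ j ih =>
    rw [Finset.prod_Icc_succ_top (by omega), map_mul, ih, factor_once j.add_one_ne_zero, map_pow,
      pow_choose_succ]

theorem map_prod_factor_atMostOnce (y : R) (a : ℕ) :
    F (∏ i ∈ Finset.Ico (a + 1) (n + 1), factor i (atMostOnce y)) =
      tail (F X) n (F (C y)) (a + 1) := by
  rw [map_prod, tail]
  refine Finset.prod_congr rfl fun i hi => ?_
  rw [factor_atMostOnce (by have := Finset.mem_Ico.1 hi; omega), map_add, map_mul, map_pow, map_one]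

theorem map_prod_factor_atLeastOnce (hF : F X ^ (n + 1) = 0) (j : ℕ) :
    F (∏ i ∈ Finset.Icc 1 j, factor i atLeastOnce) =
      F X ^ (j + 1).choose 2 * (rising (F X) 1 j * invFactorial (F X) j) := by
  induction j with
  | zero => simp [rising, invFactorial]
  | succ j ih =>
    have h := congrArg F (one_sub_mul_factor_atLeastOnce (R := R) j.add_one_ne_zero)
    simp only [map_mul, map_sub, map_add, map_one, map_pow] at h
    have h' := one_sub_pow_mul_inverse hF j.add_one_ne_zero
    have h'' : F (factor (j + 1) atLeastOnce) =
        Ring.inverse (1 - F X ^ (j + 1)) * (F X ^ (j + 1) * (1 + F X ^ (j + 1))) := by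
      linear_combination Ring.inverse (1 - F X ^ (j + 1)) * h - F (factor (j + 1) atLeastOnce) * h'
    rw [Finset.prod_Icc_succ_top (by omega), map_mul, ih, h'', pow_choose_succ, rising_succ,
      invFactorial, invFactorial, Finset.prod_range_succ, add_comm 1 j]
    ring

end Quotient

/-- The weighted count of partitions of `n` behind the theorem: `j` and `p` run over the lengths of
a marked initial chain of parts. -/
theorem sum_once_atMostOnce_eq_sum_atLeastOnce_atMostOnce (n : ℕ) {ε : R} (hε : ε = 1 ∨ ε = -1) :
    ∑ π : n.Partition, ∑ j ∈ Finset.range (n + 1), ε ^ j *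
        ∏ i ∈ Finset.Icc 1 n, (if i ≤ j then once else atMostOnce (-ε)) (π.parts.count i) =
      ∑ π : n.Partition, ∑ p ∈ Finset.range (n + 1), (-ε) ^ p *
        ∏ i ∈ Finset.Icc 1 n, (if i ≤ p then atLeastOnce else atMostOnce ε) (π.parts.count i) := by
  have key (δ y : R) (f : ℕ → R) :
      ∑ π : n.Partition, ∑ j ∈ Finset.range (n + 1), δ ^ j *
          ∏ i ∈ Finset.Icc 1 n, (if i ≤ j then f else atMostOnce y) (π.parts.count i) =
        coeff n (∑ j ∈ Finset.range (n + 1), C δ ^ j * ((∏ i ∈ Finset.Icc 1 j, factor i f) *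
          ∏ i ∈ Finset.Ico (j + 1) (n + 1), factor i (atMostOnce y))) := by
    rw [Finset.sum_comm, map_sum]
    refine Finset.sum_congr rfl fun j hj => ?_
    rw [← Finset.mul_sum, ← prod_factor_ite _ _ (Finset.mem_range_succ_iff.1 hj), ← map_pow,
      coeff_C_mul, coeff_prod_factor]
  rw [key, key, ← sub_eq_zero, ← map_sub]
  -- Only the powers up to `X ^ n` matter, so the power series can be taken modulo `X ^ (n + 1)`.
  refine X_pow_dvd_iff.1 ?_ n n.lt_succ_self
  rw [← Ideal.mem_span_singleton, ← Ideal.Quotient.eq]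
  set F := Ideal.Quotient.mk (Ideal.span {(X : R⟦X⟧) ^ (n + 1)})
  have hF : F X ^ (n + 1) = 0 := by
    rw [← map_pow]
    exact Ideal.Quotient.eq_zero_iff_mem.2 (Ideal.mem_span_singleton_self _)
  have hε' : F (C ε) = 1 ∨ F (C ε) = -1 := by
    rcases hε with rfl | rfl <;> simp
  simp only [map_sum, map_mul F, map_pow F, map_prod_factor_once, map_prod_factor_atMostOnce,
    map_prod_factor_atLeastOnce F hF, map_neg]
  exact sum_tail_eq_sum_rising_tail hF hε'

end Nat.Partition

/-! ### The weights as alternating sums of multiplicative weights -/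

namespace IntPartition

open FreqWeight

variable (π : IntPartition)

theorem mem_Icc_of_mem_parts {i : ℕ} (h : i ∈ π.2.parts) : i ∈ Finset.Icc 1 π.1 :=
  Finset.mem_Icc.2 ⟨π.2.parts_pos h, π.2.le_of_mem_parts h⟩

theorem le_t_iff (j : ℕ) : j ≤ π.t ↔ ∀ i ∈ Finset.Icc 1 j, π.freq i ≠ 0 := by
  rw [t, Nat.le_find_iff]
  refine ⟨fun h i hi => ?_, fun h m hm => h _ (Finset.mem_Icc.2 ⟨by omega, by omega⟩)⟩
  obtain ⟨h1, h2⟩ := Finset.mem_Icc.1 hi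
  have := h (i - 1) (by omega)
  rwa [Nat.sub_add_cancel h1] at this

theorem p_two_le_iff (j : ℕ) :
    π.p 2 ≤ j ↔ ∀ i ∈ Finset.Icc 1 π.1, j < i → π.freq i ≤ 1 := by
  rw [p, Finset.sup_le_iff]
  refine ⟨fun h i _ hij => ?_, fun h i hi => ?_⟩
  · by_contra! h2
    have : i ∈ π.partsWithFreqGE 2 := Finset.mem_filter.2
      ⟨Multiset.mem_toFinset.2 (Multiset.count_pos.1 (show 0 < π.freq i by omega)), h2⟩
    exact absurd (h i this) (by simpa using hij)
  · obtain ⟨hi, h2⟩ := Finset.mem_filter.1 hi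
    by_contra! hj
    have := h i (π.mem_Icc_of_mem_parts (Multiset.mem_toFinset.1 hi)) hj
    omega

theorem t_le : π.t ≤ π.1 := by
  by_contra! h
  have := (π.le_t_iff (π.1 + 1)).1 h (π.1 + 1) (Finset.mem_Icc.2 ⟨by omega, le_rfl⟩)
  exact this (Multiset.count_eq_zero.2 fun h => by
    have := (Finset.mem_Icc.1 (π.mem_Icc_of_mem_parts h)).2
    omega)

theorem numParts_eq_sum : π.numParts = ∑ i ∈ Finset.Icc 1 π.1, π.freq i :=
  (Multiset.sum_count_eq_card fun _ h => π.mem_Icc_of_mem_parts h).symm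

theorem prod_ite_le_freq_eq_pow_r {j : ℕ} (hj : j ≠ 0) (x : ℚ) :
    ∏ i ∈ Finset.Icc 1 π.1, (if j ≤ π.freq i then x else 1) = x ^ π.r j := by
  have h : π.partsWithFreqGE j = {i ∈ Finset.Icc 1 π.1 | j ≤ π.freq i} := by
    ext i
    simp only [partsWithFreqGE, Finset.mem_filter, Multiset.mem_toFinset]
    refine ⟨fun h => ⟨π.mem_Icc_of_mem_parts h.1, h.2⟩, fun h => ⟨?_, h.2⟩⟩
    exact Multiset.count_pos.1 (show 0 < π.freq i by omega)
  rw [Finset.prod_ite, Finset.prod_const, Finset.prod_const_one, mul_one, r, h]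

/-- The product of `-1` over `1 ≤ i ≤ j` that vanishes unless the chain reaches `j`. -/
theorem prod_chain {j : ℕ} (hj : j ≤ π.1) :
    ∏ i ∈ Finset.Icc 1 π.1, (if i ≤ j then if π.freq i = 0 then 0 else -1 else (1 : ℚ)) =
      if j ≤ π.t then (-1) ^ j else 0 := by
  rw [← Finset.prod_filter]
  have h : {i ∈ Finset.Icc 1 π.1 | i ≤ j} = Finset.Icc 1 j := by ext; simp; omega
  rw [h]
  split_ifs with ht
  · rw [Finset.prod_congr rfl fun i hi => if_neg ((π.le_t_iff j).1 ht i hi)]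
    simp
  · rw [le_t_iff] at ht
    push Not at ht
    obtain ⟨i, hi, h0⟩ := ht
    exact Finset.prod_eq_zero hi (if_pos h0)

theorem pow_mul_prod_ite (x : ℚ) {j : ℕ} (hj : j ≤ π.1) (f g : ℕ → ℚ) :
    x ^ j * ∏ i ∈ Finset.Icc 1 π.1, (if i ≤ j then f else g) (π.freq i) =
      ∏ i ∈ Finset.Icc 1 π.1, if i ≤ j then x * f (π.freq i) else g (π.freq i) := by
  have h : x ^ j = ∏ i ∈ Finset.Icc 1 π.1, if i ≤ j then x else 1 := by
    rw [← Finset.prod_filter]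
    have h : {i ∈ Finset.Icc 1 π.1 | i ≤ j} = Finset.Icc 1 j := by ext; simp; omega
    simp [h]
  rw [h, ← Finset.prod_mul_distrib]
  refine Finset.prod_congr rfl fun i _ => ?_
  split_ifs <;> simp

theorem sum_Icc_neg_one_pow {a b : ℕ} (h : a ≤ b) :
    ∑ k ∈ Finset.Icc a b, (-1 : ℚ) ^ k = ((-1) ^ b + (-1) ^ a) / 2 := by
  induction b, h using Nat.le_induction with
  | base => simp
  | succ b hb ih =>
    rw [Finset.sum_Icc_succ_top (by omega), ih, pow_succ]
    ring

/-- The sign `(-1) ^ j` can be distributed over the chain `1, …, j`, which leaves `-ε` for each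
part. -/
theorem pow_mul_prod_once (ε : ℚ) {j : ℕ} (hj : j ≤ π.1) :
    ε ^ j * ∏ i ∈ Finset.Icc 1 π.1, (if i ≤ j then once else atMostOnce (-ε)) (π.freq i) =
      distinct.indicator (fun π => (-ε) ^ π.numParts * if j ≤ π.t then (-1) ^ j else 0) π := by
  rw [pow_mul_prod_ite π ε hj]
  by_cases hd : π ∈ distinct
  · rw [Set.indicator_of_mem hd, ← prod_chain π hj, numParts_eq_sum, ← Finset.prod_pow_eq_pow_sum,
      ← Finset.prod_mul_distrib]
    refine Finset.prod_congr rfl fun i _ => ?_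
    have : π.freq i = 0 ∨ π.freq i = 1 := by
      have := hd i
      omega
    rcases this with h | h <;> split_ifs <;> simp_all [once, atMostOnce]
  · rw [Set.indicator_of_notMem hd]
    simp only [distinct, Set.mem_ofPred_eq, not_forall, not_le] at hd
    obtain ⟨i, hi⟩ := hd
    refine Finset.prod_eq_zero (π.mem_Icc_of_mem_parts
      (Multiset.count_pos.1 (show 0 < π.freq i by omega))) ?_
    have h0 : π.freq i ≠ 0 := by omega
    have h1 : π.freq i ≠ 1 := by omega
    simp [once, atMostOnce, h0, h1]

/-- On distinct partitions, `w` is an alternating sum over the initial segments of the chain. -/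
theorem sum_once_eq_w {ε : ℚ} {i : ℕ} (hi : (-1) ^ i = -ε) :
    ∑ j ∈ Finset.range (π.1 + 1), ε ^ j *
        ∏ k ∈ Finset.Icc 1 π.1, (if k ≤ j then once else atMostOnce (-ε)) (π.freq k) =
      distinct.indicator (w i) π := by
  rw [Finset.sum_congr rfl fun j hj =>
    pow_mul_prod_once π ε (Finset.mem_range_succ_iff.1 hj)]
  by_cases hd : π ∈ distinct
  · have h : {j ∈ Finset.range (π.1 + 1) | j ≤ π.t} = Finset.Icc 0 π.t := by
      have := π.t_le
      ext; simp; omega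
    simp only [Set.indicator_of_mem hd]
    rw [← Finset.mul_sum, ← Finset.sum_filter, h, sum_Icc_neg_one_pow (Nat.zero_le _), w, pow_mul,
      hi, mul_comm]
    congr 1
    by_cases h1 : π.freq 1 = 0
    · have ht : π.t = 0 := by
        by_contra h
        exact (π.le_t_iff 1).1 (Nat.one_le_iff_ne_zero.2 h) 1 (by simp) h1
      simp [h1, ht]
    · have h1' : π.freq 1 = 1 := by
        have := hd 1
        omega
      rw [h1']
      push_cast
      ring
  · simp [hd]

/-- The sign `(-1) ^ j` can be distributed over the chain `1, …, j`, which leaves `ε` for each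
different part and `2` for each repeated one. -/
theorem pow_mul_prod_atLeastOnce (ε : ℚ) {j : ℕ} (hj : j ≤ π.1) :
    (-ε) ^ j *
        ∏ i ∈ Finset.Icc 1 π.1, (if i ≤ j then atLeastOnce else atMostOnce ε) (π.freq i) =
      if π.p 2 ≤ j ∧ j ≤ π.t then ε ^ π.r 1 * 2 ^ π.r 2 * (-1) ^ j else 0 := by
  rw [pow_mul_prod_ite π (-ε) hj]
  by_cases hp : π.p 2 ≤ j
  · simp only [hp, true_and]
    rw [← mul_ite_zero, ← prod_chain π hj, ← prod_ite_le_freq_eq_pow_r π one_ne_zero,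
      ← prod_ite_le_freq_eq_pow_r π two_ne_zero, ← Finset.prod_mul_distrib,
      ← Finset.prod_mul_distrib]
    refine Finset.prod_congr rfl fun i hi => ?_
    have h2 : i ≤ j ∨ π.freq i ≤ 1 :=
      (le_or_gt i j).imp_right ((π.p_two_le_iff j).1 hp i hi)
    rcases hf : π.freq i with _ | _ | m
    · simp [atLeastOnce, atMostOnce]
    · split_ifs <;> simp_all [atLeastOnce, atMostOnce]
    · have hij : i ≤ j := h2.resolve_right (by omega)
      simp [hij, atLeastOnce]
  · rw [if_neg (by tauto)]
    rw [p_two_le_iff] at hp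
    push Not at hp
    obtain ⟨i, hi, hij, h2⟩ := hp
    refine Finset.prod_eq_zero hi ?_
    have h0 : π.freq i ≠ 0 := by omega
    have h1 : π.freq i ≠ 1 := by omega
    simp [hij.not_ge, atMostOnce, h0, h1]

/-- On partitions with `p 2 ≤ t`, `wHat` is an alternating sum over the initial segments of the
chain that reach `p 2`. -/
theorem sum_atLeastOnce_eq_wHat {ε : ℚ} (hε : ε = 1 ∨ ε = -1) {i : ℕ}
    (hi : (-1) ^ (i - 1) = ε) :
    ∑ j ∈ Finset.range (π.1 + 1), (-ε) ^ j *
        ∏ k ∈ Finset.Icc 1 π.1, (if k ≤ j then atLeastOnce else atMostOnce ε) (π.freq k) =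
      chainBounded.indicator (wHat i) π := by
  rw [Finset.sum_congr rfl fun j hj =>
    pow_mul_prod_atLeastOnce π ε (Finset.mem_range_succ_iff.1 hj), ← Finset.sum_filter]
  have h : {j ∈ Finset.range (π.1 + 1) | π.p 2 ≤ j ∧ j ≤ π.t} = Finset.Icc (π.p 2) π.t := by
    have := π.t_le
    ext; simp; omega
  rw [h, ← Finset.mul_sum]
  by_cases hp : π.p 2 ≤ π.t
  · rw [Set.indicator_of_mem (show π ∈ chainBounded from hp), sum_Icc_neg_one_pow hp, wHat,
      pow_mul, hi, add_assoc, pow_add]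
    -- The factor `ε ^ (t + p 2)` is `1` unless `t` and `p 2` have different parities.
    rcases hε with rfl | rfl
    · simp
    · rw [pow_add]
      rcases neg_one_pow_eq_or ℚ π.t with ht | ht <;>
        rcases neg_one_pow_eq_or ℚ (π.p 2) with hp | hp <;> rw [ht, hp] <;> ring
  · rw [Set.indicator_of_notMem (show π ∉ chainBounded from hp),
      Finset.Icc_eq_empty hp, Finset.sum_empty, mul_zero]

/-- A series over a set of partitions converges coefficientwise. -/
theorem hasSum_smul_X_pow_size (s : Set IntPartition) (c : IntPartition → ℚ) :
    HasSum (fun π : s => c π • (PowerSeries.X : ℚ⟦X⟧) ^ π.1.size)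
      (PowerSeries.mk fun n => ∑ π : n.Partition, s.indicator c ⟨n, π⟩) := by
  rw [PowerSeries.WithPiTopology.hasSum_iff_hasSum_coeff]
  intro n
  rw [PowerSeries.coeff_mk]
  let F : IntPartition → ℚ := fun π => c π * if n = π.1 then 1 else 0
  have hF : (fun π : s => PowerSeries.coeff n (c π • (PowerSeries.X : ℚ⟦X⟧) ^ π.1.size)) =
      F ∘ (↑) := by
    funext π
    simp [F, PowerSeries.coeff_X_pow, size, π.1.2.parts_sum]
  rw [hF, hasSum_subtype_iff_indicator]
  have hsum : ∑ π : n.Partition, s.indicator c ⟨n, π⟩ =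
      ∑ π ∈ Finset.univ.map (Function.Embedding.sigmaMk (β := Nat.Partition) n),
        s.indicator F π := by
    rw [Finset.sum_map]
    refine Finset.sum_congr rfl fun π _ => ?_
    by_cases h : (⟨n, π⟩ : IntPartition) ∈ s <;> simp [h, F]
  rw [hsum]
  refine hasSum_sum_of_ne_finset_zero fun π hπ => ?_
  have hn : n ≠ π.1 := by
    rintro rfl
    exact hπ (Finset.mem_map.2 ⟨π.2, Finset.mem_univ _, rfl⟩)
  simp [F, hn]

theorem sum_indicator_w_eq_sum_indicator_wHat {i : ℕ} (hi : i = 1 ∨ i = 2) (n : ℕ) :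
    ∑ π : n.Partition, distinct.indicator (w i) ⟨n, π⟩ =
      ∑ π : n.Partition, chainBounded.indicator (wHat i) ⟨n, π⟩ := by
  obtain ⟨ε, hε, h1, h2⟩ : ∃ ε : ℚ, (ε = 1 ∨ ε = -1) ∧ (-1) ^ i = -ε ∧ (-1) ^ (i - 1) = ε := by
    rcases hi with rfl | rfl
    · exact ⟨1, by norm_num⟩
    · exact ⟨-1, by norm_num⟩
  simp only [← sum_once_eq_w _ h1, ← sum_atLeastOnce_eq_wHat _ hε h2]
  exact Nat.Partition.sum_once_atMostOnce_eq_sum_atLeastOnce_atMostOnce n hε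

end IntPartition

theorem theorem5 (i : ℕ) (hi : i = 1 ∨ i = 2) :
    Summable (fun π : IntPartition.distinct =>
      π.1.w i • (PowerSeries.X : ℚ⟦X⟧) ^ π.1.size) ∧
    Summable (fun π : IntPartition.chainBounded =>
      π.1.wHat i • (PowerSeries.X : ℚ⟦X⟧) ^ π.1.size) ∧
    ∑' π : IntPartition.distinct, π.1.w i • (PowerSeries.X : ℚ⟦X⟧) ^ π.1.size =
      ∑' π : IntPartition.chainBounded,
        π.1.wHat i • (PowerSeries.X : ℚ⟦X⟧) ^ π.1.size := by
  have h1 := IntPartition.hasSum_smul_X_pow_size IntPartition.distinct (IntPartition.w i)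
  have h2 := IntPartition.hasSum_smul_X_pow_size IntPartition.chainBounded (IntPartition.wHat i)
  refine ⟨h1.summable, h2.summable, ?_⟩
  rw [h1.tsum_eq, h2.tsum_eq]
  ext n
  simpa using IntPartition.sum_indicator_w_eq_sum_indicator_wHat hi n
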